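/- Fix an integer $p \geq 3$ and equip $\{1, \ldots, p\}$ with the discrete metric $d(i, j) = 1 - \mathbb{I}(i = j)$. For a distribution $P$ on a metric space $(\mathcal{X}, d)$ let $$O(P) = \frac{E\{ d(X_1, X_2)^2 d(X_1, X_3)^2 \}}{E\{ d(X_1, X_2)^4 \}}, \qquad X_1, X_2, X_3 \sim P \text{ independent},$$ denote its object shape. Let $X_1, X_2, \ldots$ be independent and uniformly distributed on $\{1, \ldots, p\}$, let $P_n = \frac{1}{n} \sum_{k=1}^n \delta_{X_k}$ be the empirical distribution of $X_1, \ldots, X_n$, let $n_i$ be the number of $k \leq n$ with $X_k = i$, and let $$T_n = \sum_{i=1}^p n p \left( \frac{n_i}{n} - \frac{1}{p} \right)^2$$ be Pearson's chi squared statistic. (On the event $X_1 = \cdots = X_n$, where $O(P_n)$ is of the form $0/0$, put $O(P_n) = 0$; the probability of this event is $p^{1-n} \to 0$.) Then, as $n \to \infty$, $$\frac{p(p-1)}{p-2}\, n \left\{ 1 - \frac{1}{p} - O(P_n) \right\} = T_n + o_p(1) \rightsquigarrow \chi^2_{p-1},$$ that is, the difference between the left-hand side and $T_n$ converges to $0$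 in probability, and the left-hand side converges in distribution to the chi squared distribution with $p - 1$ degrees of freedom. -/

import Mathlib

open MeasureTheory ProbabilityTheory Filter
open scoped ENNReal

noncomputable section

/-- The object shape `O(P) = E{d(X₁, X₂)² d(X₁, X₃)²} / E{d(X₁, X₂)⁴}`, with `X₁, X₂, X₃`
independent draws from `P`. -/
def objectShape {E : Type*} [MetricSpace E] [MeasurableSpace E] (P : Measure E) : ℝ :=
  (∫ x, dist x.1 x.2.1 ^ 2 * dist x.1 x.2.2 ^ 2 ∂(P.prod (P.prod P))) /
    (∫ x, dist x.1 x.2 ^ 4 ∂(P.prod P))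

/-- The empirical distribution of the first `n` observations `x 0, …, x (n - 1)`. -/
def empiricalDist {E : Type*} [MeasurableSpace E] (x : ℕ → E) (n : ℕ) : Measure E :=
  (n : ℝ≥0∞)⁻¹ • ∑ k ∈ Finset.range n, Measure.dirac (x k)

/-- A set of `p` points, to be equipped with the discrete metric. -/
def Points (p : ℕ) : Type := Fin p

instance (p : ℕ) : Fintype (Points p) := inferInstanceAs (Fintype (Fin p))

instance (p : ℕ) : DecidableEq (Points p) := inferInstanceAs (DecidableEq (Fin p))

/-- The discrete metric `d(i, j) = 1 - 𝕀(i = j)`. -/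
instance (p : ℕ) : MetricSpace (Points p) where
  dist i j := 1 - (if i = j then 1 else 0)
  dist_self i := by simp
  dist_comm i j := by simp only [eq_comm]
  dist_triangle i j k := by
    by_cases h1 : i = j <;> by_cases h2 : j = k <;> by_cases h3 : i = k <;> simp_all
  eq_of_dist_eq_zero {i j} h := by
    by_contra hij
    simp [hij] at h

instance (p : ℕ) : MeasurableSpace (Points p) := ⊤

instance (p : ℕ) : DiscreteMeasurableSpace (Points p) := ⟨fun _ => trivial⟩

/-- The discrete distribution `P_θ` giving the point `i` the mass `θ i`. -/
def discreteDist {p : ℕ} (θ : Points p → ℝ) : Measure (Points p) :=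
  ∑ i, ENNReal.ofReal (θ i) • Measure.dirac i

/-- The number `n_i` of the first `n` observations that are equal to `i`. -/
def pointCount {p : ℕ} (x : ℕ → Points p) (n : ℕ) (i : Points p) : ℕ :=
  ((Finset.range n).filter (fun k => x k = i)).card

/-- Pearson's chi squared statistic `T_n` for uniformity. -/
def pearsonStat {p : ℕ} (x : ℕ → Points p) (n : ℕ) : ℝ :=
  ∑ i : Points p, (n : ℝ) * p * ((pointCount x n i : ℝ) / n - 1 / p) ^ 2

/-- The chi squared distribution with `k` degrees of freedom: the law of the sum of squares of
`k` independent standard normal random variables. -/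
def chiSquared (k : ℕ) : Measure ℝ :=
  (Measure.pi (fun _ : Fin k => gaussianReal 0 1)).map (fun z => ∑ i, z i ^ 2)

instance (k : ℕ) : IsProbabilityMeasure (chiSquared k) :=
  Measure.isProbabilityMeasure_map
    (by fun_prop : Measurable (fun z : Fin k → ℝ => ∑ i, z i ^ 2)).aemeasurable

end

/-! Put `e i = θ i - 1 / p`, `q = ∑ e i ^ 2`, `m = ∑ |e i|`. As `∑ e i = 0`, the linear terms vanish
from the numerator and denominator of the object shape, and its scaled deficit is `p * q` up to a
relative error of at most `(q + (p - 1) / (p - 2) * m) / (1 - 1 / p - q)`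
(`abs_weightShape_expansion_le`). At the empirical frequencies `n * p * q` is Pearson's statistic,
and by the strong law the relative error tends to 0 almost surely.

Pearson's statistic is the squared norm of a normalized sum of i.i.d. vectors in the hyperplane of
zero coordinate sum, with identity covariance there; the central limit theorem and continuous
mapping give the chi squared limit. By Slutsky, statistic times relative error tends to 0 in
probability, which yields both claims. -/

/-! ### Limit theorems and Gaussian vectors -/

/-- Convergence in distribution to a constant implies convergence in probability. -/
theorem tendstoInMeasure_of_tendstoInDistribution_const {Ω Ω' : Type*} [MeasurableSpace Ω]
    [MeasurableSpace Ω'] {μ : Measure Ω} [IsProbabilityMeasure μ] {ν : Measure Ω'}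
    [IsProbabilityMeasure ν] {X : ℕ → Ω → ℝ} {c : ℝ}
    (h : TendstoInDistribution X atTop (fun _ : Ω' => c) (fun _ => μ) ν) :
    TendstoInMeasure μ X atTop (fun _ => c) := by
  rw [tendstoInMeasure_iff_norm]
  intro ε hε
  have hclosed : IsClosed {x : ℝ | ε ≤ ‖x - c‖} := isClosed_le (by fun_prop) (by fun_prop)
  have hc : c ∉ {x : ℝ | ε ≤ ‖x - c‖} := by simpa using hε
  have hmap : ν.map (fun _ : Ω' => c) = Measure.dirac c := by simp
  -- Portmanteau: the closed set omits `c`, so the limit `dirac c` charges neither it nor its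
  -- frontier.
  have hlim := ProbabilityMeasure.tendsto_measure_of_null_frontier_of_tendsto' h.tendsto
    (E := {x : ℝ | ε ≤ ‖x - c‖}) (by
      simp only [ProbabilityMeasure.coe_mk, hmap]
      rw [Measure.dirac_apply' _ isClosed_frontier.measurableSet]
      exact Set.indicator_of_notMem (fun hf => hc (hclosed.frontier_subset hf)) _)
  simp only [ProbabilityMeasure.coe_mk, hmap] at hlim
  rw [Measure.dirac_apply' _ hclosed.measurableSet, Set.indicator_of_notMem hc] at hlim
  refine hlim.congr fun n => ?_
  rw [Measure.map_apply_of_aemeasurable (h.forall_aemeasurable n) hclosed.measurableSet]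
  rfl

/-- The central limit theorem for independent identically distributed random vectors that are
centered with covariance the identity. -/
theorem tendstoInDistribution_inv_sqrt_smul_sum_stdGaussian {E Ω : Type*} [NormedAddCommGroup E]
    [InnerProductSpace ℝ E] [FiniteDimensional ℝ E] [MeasurableSpace E] [BorelSpace E]
    [MeasurableSpace Ω] {μ : Measure Ω} [IsProbabilityMeasure μ] {Y : ℕ → Ω → E}
    (hindep : iIndepFun Y μ) (hident : ∀ k, IdentDistrib (Y k) (Y 0) μ μ)
    (hmean : ∀ t : E, ∫ ω, inner ℝ (Y 0 ω) t ∂μ = 0)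
    (hcov : ∀ t : E, ∫ ω, inner ℝ (Y 0 ω) t ^ 2 ∂μ = ‖t‖ ^ 2) :
    TendstoInDistribution (fun (n : ℕ) ω => (√n)⁻¹ • ∑ k ∈ Finset.range n, Y k ω) atTop
      (id : E → E) (fun _ => μ) (stdGaussian E) where
  forall_aemeasurable n :=
    (Finset.aemeasurable_fun_sum _ fun k _ => (hident k).aemeasurable_fst).const_smul _
  aemeasurable_limit := aemeasurable_id
  tendsto := by
    have hY k : AEMeasurable (Y k) μ := (hident k).aemeasurable_fst
    have hS (n : ℕ) : AEMeasurable (fun ω => (√n)⁻¹ • ∑ k ∈ Finset.range n, Y k ω) μ :=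
      (Finset.aemeasurable_fun_sum _ fun k _ => hY k).const_smul _
    refine ProbabilityMeasure.tendsto_iff_tendsto_charFun.2 fun t => ?_
    simp only [ProbabilityMeasure.coe_mk, Measure.map_id, charFun_stdGaussian]
    rcases eq_or_ne t 0 with rfl | ht
    · have (n : ℕ) : IsProbabilityMeasure
          (μ.map fun ω => (√n)⁻¹ • ∑ k ∈ Finset.range n, Y k ω) :=
        Measure.isProbabilityMeasure_map (hS n)
      simp
    have ht' : ‖t‖ ≠ 0 := norm_ne_zero_iff.2 ht
    -- Cramér–Wold: along the unit direction `u` the variance is 1, and the one-dimensional limit is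
    -- evaluated at `‖t‖`.
    let u : E := ‖t‖⁻¹ • t
    have hu : ‖u‖ = 1 := norm_smul_inv_norm ht
    have hmeas : Measurable fun y : E => inner ℝ y u := by fun_prop
    have hV : iIndepFun (fun k ω => inner ℝ (Y k ω) u) μ :=
      hindep.comp (fun _ y => inner ℝ y u) fun _ => hmeas
    have hVident (k : ℕ) : IdentDistrib (fun ω => inner ℝ (Y k ω) u)
        (fun ω => inner ℝ (Y 0 ω) u) μ μ := (hident k).comp hmeas
    have key := tendsto_charFun_inv_sqrt_mul_pow (hVident 0).aemeasurable_fst (hmean u)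
      (by simpa [hu] using hcov u) ‖t‖
    refine key.congr fun n => ?_
    rw [← charFun_inv_sqrt_mul_sum hV hVident, charFun_apply, charFun_apply,
      integral_map (hS n) (by fun_prop), integral_map
        ((Finset.aemeasurable_fun_sum _ fun k _ => (hVident k).aemeasurable_fst).const_mul _)
        (by fun_prop)]
    congr! 5 with ω
    simp only [u, inner_smul_left, inner_smul_right, sum_inner, Real.inner_apply, RCLike.conj_to_real,
      ← Finset.mul_sum]
    field_simp

/-- The squared norm of a standard Gaussian vector has a chi squared distribution. -/
theorem stdGaussian_map_norm_sq {E : Type*} [NormedAddCommGroup E] [InnerProductSpace ℝ E]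
    [FiniteDimensional ℝ E] [MeasurableSpace E] [BorelSpace E] {k : ℕ}
    (hk : Module.finrank ℝ E = k) :
    (stdGaussian E).map (fun x => ‖x‖ ^ 2) = chiSquared k := by
  let f : E ≃ₗᵢ[ℝ] EuclideanSpace ℝ (Fin k) :=
    ((stdOrthonormalBasis ℝ E).reindex (finCongr hk)).repr
  have h : (stdGaussian E).map (fun x => ‖x‖ ^ 2) =
      (stdGaussian (EuclideanSpace ℝ (Fin k))).map (fun x => ‖x‖ ^ 2) := by
    rw [← stdGaussian_map f, Measure.map_map (by fun_prop) (by fun_prop)]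
    simp [Function.comp_def]
  rw [h, ← map_pi_eq_stdGaussian, Measure.map_map (by fun_prop) (by fun_prop), chiSquared]
  congr 1
  ext z
  simp [EuclideanSpace.norm_sq_eq]

/-! ### Object shape on the discrete space -/

/-- The object shape of the discrete distribution with weights `θ`. -/
noncomputable def weightShape {ι : Type*} [Fintype ι] (θ : ι → ℝ) : ℝ :=
  (∑ i, θ i * (1 - θ i) ^ 2) / ∑ i, θ i * (1 - θ i)

theorem Points.dist_eq {p : ℕ} (i j : Points p) : dist i j = 1 - (if i = j then 1 else 0) := rfl

/-- Distances are 0 or 1, so every positive power is the indicator of `j ≠ i`. -/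
theorem Points.sum_measureReal_mul_dist_pow {p : ℕ} (P : Measure (Points p))
    [IsProbabilityMeasure P] (i : Points p) {m : ℕ} (hm : m ≠ 0) :
    ∑ j, P.real {j} * dist i j ^ m = 1 - P.real {i} := by
  have h1 : ∑ j, P.real {j} = 1 := by simp
  have h2 (j : Points p) : P.real {j} * dist i j ^ m =
      P.real {j} - if i = j then P.real {j} else 0 := by
    rw [Points.dist_eq]
    split_ifs <;> simp [hm]
  simp [h2, Finset.sum_sub_distrib, h1]

/-- Given `X₁ = i`, the other two draws are independent, so the double sum factors into a square. -/
theorem objectShape_eq_weightShape {p : ℕ} (P : Measure (Points p)) [IsProbabilityMeasure P] :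
    objectShape P = weightShape (fun i => P.real {i}) := by
  have hsing {α β : Type} [MeasurableSpace α] [MeasurableSpace β] (μ : Measure α) (ν : Measure β)
      [SFinite ν] (x : α) (y : β) : (μ.prod ν).real {(x, y)} = μ.real {x} * ν.real {y} := by
    rw [← Set.singleton_prod_singleton, measureReal_prod_prod]
  rw [objectShape, weightShape, integral_fintype .of_finite, integral_fintype .of_finite]
  congr 1
  · simp_rw [Fintype.sum_prod_type, hsing, smul_eq_mul]
    refine Finset.sum_congr rfl fun i _ => ?_
    rw [← Points.sum_measureReal_mul_dist_pow P i two_ne_zero, sq (∑ j, _), Finset.sum_mul_sum,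
      Finset.mul_sum]
    refine Finset.sum_congr rfl fun j _ => ?_
    rw [Finset.mul_sum]
    exact Finset.sum_congr rfl fun k _ => by ring
  · simp_rw [Fintype.sum_prod_type, hsing, smul_eq_mul]
    refine Finset.sum_congr rfl fun i _ => ?_
    rw [← Points.sum_measureReal_mul_dist_pow P i four_ne_zero, Finset.mul_sum]
    exact Finset.sum_congr rfl fun k _ => by ring

theorem empiricalDist_isProbabilityMeasure {E : Type*} [MeasurableSpace E] (x : ℕ → E) {n : ℕ}
    (hn : n ≠ 0) : IsProbabilityMeasure (empiricalDist x n) := by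
  constructor
  simp only [empiricalDist, Measure.smul_apply, Measure.finsetSum_apply, measure_univ,
    Finset.sum_const, Finset.card_range, nsmul_eq_mul, mul_one, smul_eq_mul]
  exact ENNReal.inv_mul_cancel (by simpa) (by simp)

theorem empiricalDist_real_singleton {p : ℕ} (x : ℕ → Points p) (n : ℕ) (i : Points p) :
    (empiricalDist x n).real {i} = pointCount x n i / n := by
  rw [measureReal_def, empiricalDist, pointCount]
  simp [Set.indicator_apply, Finset.sum_boole, div_eq_inv_mul]

theorem pointCount_eq_sum {p : ℕ} (x : ℕ → Points p) (n : ℕ) (i : Points p) :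
    (pointCount x n i : ℝ) = ∑ k ∈ Finset.range n, if x k = i then 1 else 0 := by
  simp [pointCount]

theorem sum_pointCount {p : ℕ} (x : ℕ → Points p) (n : ℕ) :
    ∑ i, (pointCount x n i : ℝ) = n := by
  simp_rw [pointCount_eq_sum]
  rw [Finset.sum_comm]
  simp

theorem objectShape_empiricalDist {p : ℕ} (x : ℕ → Points p) {n : ℕ} (hn : n ≠ 0) :
    objectShape (empiricalDist x n) = weightShape (fun i => (pointCount x n i : ℝ) / n) := by
  have := empiricalDist_isProbabilityMeasure x hn
  simp [objectShape_eq_weightShape, empiricalDist_real_singleton]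

/-- Second order expansion of the object shape around the uniform weights. -/
theorem abs_weightShape_expansion_le {p : ℕ} (hp : 3 ≤ p) (θ : Points p → ℝ)
    (hθ : ∑ i, θ i = 1) (hlt : ∑ i, (θ i - 1 / p) ^ 2 < 1 - 1 / (p : ℝ)) :
    |(p : ℝ) * (p - 1) / (p - 2) * (1 - 1 / (p : ℝ) - weightShape θ) -
        p * ∑ i, (θ i - 1 / p) ^ 2| ≤
      (p * ∑ i, (θ i - 1 / p) ^ 2) *
        ((∑ i, (θ i - 1 / p) ^ 2 + (p - 1) / (p - 2) * ∑ i, |θ i - 1 / p|) /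
          (1 - 1 / (p : ℝ) - ∑ i, (θ i - 1 / p) ^ 2)) := by
  have hp3 : (3 : ℝ) ≤ p := by exact_mod_cast hp
  have hp0 : (p : ℝ) ≠ 0 := by positivity
  have hp2 : 0 < (p : ℝ) - 2 := by linarith
  obtain ⟨e, rfl⟩ : ∃ e : Points p → ℝ, θ = fun i => e i + 1 / p :=
    ⟨fun i => θ i - 1 / p, by simp⟩
  have hcard : Fintype.card (Points p) = p := Fintype.card_fin p
  simp only [add_sub_cancel_right] at hlt ⊢
  have he : ∑ i, e i = 0 := by
    simpa [Finset.sum_add_distrib, hcard, hp0] using hθ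
  set q := ∑ i, e i ^ 2 with hq
  set m := ∑ i, |e i|
  have hnum : ∑ i, (e i + 1 / p) * (1 - (e i + 1 / p)) ^ 2 =
      (1 - 1 / (p : ℝ)) ^ 2 - (2 - 3 / p) * q + ∑ i, e i ^ 3 := by
    have (i : Points p) : (e i + 1 / p) * (1 - (e i + 1 / p)) ^ 2 =
        1 / p * (1 - 1 / (p : ℝ)) ^ 2 + ((1 - 1 / (p : ℝ)) ^ 2 - 2 * (1 / p) * (1 - 1 / p)) * e i -
          (2 - 3 / p) * e i ^ 2 + e i ^ 3 := by ring
    simp only [this, Finset.sum_add_distrib, Finset.sum_sub_distrib, ← Finset.mul_sum, he]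
    simp only [Finset.sum_const, Finset.card_univ, hcard, nsmul_eq_mul]
    field_simp
    ring
  have hden : ∑ i, (e i + 1 / p) * (1 - (e i + 1 / p)) = 1 - 1 / (p : ℝ) - q := by
    have (i : Points p) : (e i + 1 / p) * (1 - (e i + 1 / p)) =
        1 / p * (1 - 1 / (p : ℝ)) + (1 - 2 / p) * e i - e i ^ 2 := by ring
    simp only [this, Finset.sum_add_distrib, Finset.sum_sub_distrib, ← Finset.mul_sum, he]
    simp only [Finset.sum_const, Finset.card_univ, hcard, nsmul_eq_mul]
    field_simp
    ring
  rw [weightShape, hnum, hden]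
  have hD : 0 < 1 - 1 / (p : ℝ) - q := by linarith
  set c := ∑ i, e i ^ 3
  have hc : |c| ≤ m * q := by
    calc |c| ≤ ∑ i, |e i ^ 3| := Finset.abs_sum_le_sum_abs _ _
      _ ≤ ∑ i, m * e i ^ 2 := by
        refine Finset.sum_le_sum fun i _ => ?_
        have h1 : |e i| ≤ m :=
          Finset.single_le_sum (f := fun i => |e i|) (fun j _ => abs_nonneg _) (Finset.mem_univ i)
        have h2 : |e i ^ 3| = |e i| * e i ^ 2 := by
          rw [pow_succ', abs_mul, abs_of_nonneg (sq_nonneg (e i))]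
        rw [h2]
        gcongr
      _ = m * q := by rw [Finset.mul_sum]
  have hq0 : 0 ≤ q := Finset.sum_nonneg fun i _ => sq_nonneg _
  have hm0 : 0 ≤ m := Finset.sum_nonneg fun i _ => abs_nonneg _
  generalize hDd : 1 - 1 / (p : ℝ) - q = D at hD
  -- The scaling constant is chosen so that the part linear in `q` cancels exactly.
  have hkey : (p : ℝ) * (p - 1) / (p - 2) * (1 - 1 / (p : ℝ) -
      ((1 - 1 / (p : ℝ)) ^ 2 - (2 - 3 / p) * q + c) / D) - p * q =
      (p * q ^ 2 - p * ((p - 1) / (p - 2)) * c) / D := by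
    have hq' : q = 1 - 1 / (p : ℝ) - D := by linarith
    rw [hq']
    field_simp
    ring
  rw [hkey, abs_div, abs_of_pos hD, ← mul_div_assoc (p * q)]
  have hK : 0 ≤ (p : ℝ) * ((p - 1) / (p - 2)) := by
    have : 0 < (p : ℝ) - 1 := by linarith
    positivity
  gcongr
  calc |p * q ^ 2 - p * ((p - 1) / (p - 2)) * c|
      ≤ |p * q ^ 2| + |p * ((p - 1) / (p - 2)) * c| := abs_sub _ _
    _ = p * q ^ 2 + p * ((p - 1) / (p - 2)) * |c| := by
      rw [abs_of_nonneg (by positivity), abs_mul, abs_of_nonneg hK]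
    _ ≤ p * q ^ 2 + p * ((p - 1) / (p - 2)) * (m * q) := by gcongr
    _ = _ := by ring

theorem integral_discreteDist_uniform {p : ℕ} (f : Points p → ℝ) :
    ∫ x, f x ∂(discreteDist fun _ : Points p => 1 / (p : ℝ)) = (∑ i, f i) / p := by
  rw [discreteDist, integral_finsetSum_measure
    fun i _ => (integrable_dirac (by simp)).smul_measure ENNReal.ofReal_ne_top]
  simp [integral_smul_measure, div_eq_inv_mul, Finset.mul_sum]

/-! ### Limit law of Pearson's statistic -/

/-- The vector `√p (e_j - p⁻¹ 1)`, the centered and scaled indicator of the point `j`. -/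
noncomputable def centeredIndicator {p : ℕ} (j : Points p) : EuclideanSpace ℝ (Points p) :=
  √p • (EuclideanSpace.single j 1 - (1 / (p : ℝ)) • WithLp.toLp 2 fun _ => 1)

theorem centeredIndicator_apply {p : ℕ} (j i : Points p) :
    centeredIndicator j i = √p * ((if j = i then 1 else 0) - 1 / p) := by
  simp [centeredIndicator, eq_comm]

/-- The orthogonal complement of the constant vectors. -/
noncomputable abbrev sumZero (p : ℕ) : Submodule ℝ (EuclideanSpace ℝ (Points p)) :=
  (ℝ ∙ (WithLp.toLp 2 fun _ => 1 : EuclideanSpace ℝ (Points p)))ᗮ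

theorem mem_sumZero {p : ℕ} {v : EuclideanSpace ℝ (Points p)} :
    v ∈ sumZero p ↔ ∑ i, v i = 0 := by
  rw [Submodule.mem_orthogonal_singleton_iff_inner_right]
  simp [PiLp.inner_apply]

theorem centeredIndicator_mem_sumZero {p : ℕ} (hp : p ≠ 0) (j : Points p) :
    centeredIndicator j ∈ sumZero p := by
  have hcard : Fintype.card (Points p) = p := Fintype.card_fin p
  rw [mem_sumZero]
  simp [centeredIndicator_apply, ← Finset.mul_sum, hcard, hp]

theorem finrank_sumZero {p : ℕ} (hp : p ≠ 0) : Module.finrank ℝ (sumZero p) = p - 1 := by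
  obtain ⟨k, rfl⟩ := Nat.exists_eq_succ_of_ne_zero hp
  have : Fact (Module.finrank ℝ (EuclideanSpace ℝ (Points (k + 1))) = k + 1) :=
    ⟨by rw [finrank_euclideanSpace]; exact Fintype.card_fin _⟩
  refine Submodule.finrank_orthogonal_span_singleton (n := k) fun h => ?_
  have h0 : (1 : ℝ) = 0 :=
    congrArg (fun v : EuclideanSpace ℝ (Points (k + 1)) => v (0 : Fin (k + 1))) h
  exact one_ne_zero h0

/-- The inner product of a vector with zero coordinate sum and a centered indicator. -/
theorem inner_centeredIndicator {p : ℕ} (j : Points p) {t : EuclideanSpace ℝ (Points p)}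
    (ht : t ∈ sumZero p) : inner ℝ (centeredIndicator j) t = √p * t j := by
  rw [mem_sumZero] at ht
  simp only [PiLp.inner_apply, centeredIndicator_apply, RCLike.inner_apply, conj_trivial]
  calc ∑ i, t i * (√p * ((if j = i then 1 else 0) - 1 / p))
      = √p * ∑ i, (if j = i then t i else 0) - √p * (1 / p) * ∑ i, t i := by
        rw [Finset.mul_sum, Finset.mul_sum, ← Finset.sum_sub_distrib]
        refine Finset.sum_congr rfl fun i _ => ?_
        split_ifs <;> ring
    _ = √p * t j := by simp [ht]

/-- Pearson's statistic is the squared norm of the normalized sum of centered indicators. -/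
theorem pearsonStat_eq_norm_sq {p : ℕ} (x : ℕ → Points p) (n : ℕ) :
    pearsonStat x n = ‖(√n)⁻¹ • ∑ k ∈ Finset.range n, centeredIndicator (x k)‖ ^ 2 := by
  rcases eq_or_ne n 0 with rfl | hn
  · simp [pearsonStat]
  have hn0 : (n : ℝ) ≠ 0 := by exact_mod_cast hn
  rw [pearsonStat, EuclideanSpace.norm_sq_eq]
  refine Finset.sum_congr rfl fun i _ => ?_
  have hsum : (∑ k ∈ Finset.range n, centeredIndicator (x k)) i =
      √p * (pointCount x n i - n / p) := by
    rw [WithLp.ofLp_sum, Finset.sum_apply, pointCount_eq_sum]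
    simp only [centeredIndicator_apply, ← Finset.mul_sum, Finset.sum_sub_distrib]
    simp [div_eq_mul_inv]
  rw [PiLp.smul_apply, hsum, smul_eq_mul, Real.norm_eq_abs, sq_abs, mul_pow, mul_pow, inv_pow,
    Real.sq_sqrt (by positivity), Real.sq_sqrt (by positivity)]
  field_simp

/-- Pearson's statistic converges in distribution to the chi squared distribution. -/
theorem tendstoInDistribution_pearsonStat {p : ℕ} (hp : p ≠ 0) {Ω : Type*} [MeasurableSpace Ω]
    {μ : Measure Ω} [IsProbabilityMeasure μ] {X : ℕ → Ω → Points p} (hindep : iIndepFun X μ)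
    (hlaw : ∀ k, HasLaw (X k) (discreteDist (fun _ : Points p => 1 / (p : ℝ))) μ) :
    TendstoInDistribution (fun (n : ℕ) (ω : Ω) => pearsonStat (fun k => X k ω) n)
      atTop (id : ℝ → ℝ) (fun _ => μ) (chiSquared (p - 1)) := by
  have hp0 : (p : ℝ) ≠ 0 := by exact_mod_cast hp
  -- On the whole space the covariance is a singular projection; on the hyperplane it is the
  -- identity.
  let y : Points p → sumZero p := fun j => ⟨centeredIndicator j, centeredIndicator_mem_sumZero hp j⟩
  have hy : Measurable y := .of_discrete
  have hinner (j : Points p) (t : sumZero p) : inner ℝ (y j) t = √p * (t : EuclideanSpace ℝ _) j :=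
    inner_centeredIndicator j t.2
  have hident (k : ℕ) : IdentDistrib (X k) (X 0) μ μ :=
    ⟨(hlaw k).aemeasurable, (hlaw 0).aemeasurable, by rw [(hlaw k).map_eq, (hlaw 0).map_eq]⟩
  have hexp (f : Points p → ℝ) : ∫ ω, f (X 0 ω) ∂μ = (∑ i, f i) / p := by
    rw [← integral_discreteDist_uniform]
    exact (hlaw 0).integral_comp (f := f) Measurable.of_discrete.aestronglyMeasurable
  have hclt := tendstoInDistribution_inv_sqrt_smul_sum_stdGaussian
    (hindep.comp (fun _ => y) fun _ => hy) (fun k => (hident k).comp hy)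
    (fun t => by
      simp only [Function.comp_apply]
      rw [hexp fun j => inner ℝ (y j) t]
      simp [hinner, ← Finset.mul_sum, mem_sumZero.1 t.2])
    (fun t => by
      simp only [Function.comp_apply]
      rw [hexp fun j => inner ℝ (y j) t ^ 2, Submodule.coe_norm, EuclideanSpace.norm_sq_eq]
      simp only [hinner, mul_pow, Real.sq_sqrt (Nat.cast_nonneg p), ← Finset.mul_sum,
        Real.norm_eq_abs, sq_abs]
      field_simp)
  have hsq := hclt.continuous_comp (g := fun v => ‖v‖ ^ 2) (by fun_prop)
  have hfun : (fun (n : ℕ) (ω : Ω) => pearsonStat (fun k => X k ω) n) = fun (n : ℕ) =>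
      (fun v : sumZero p => ‖v‖ ^ 2) ∘ fun ω => (√n)⁻¹ • ∑ k ∈ Finset.range n, (y ∘ X k) ω := by
    ext n ω
    rw [pearsonStat_eq_norm_sq, Function.comp_apply, Submodule.coe_norm]
    simp [y]
  rw [hfun]
  refine ⟨hsq.forall_aemeasurable, aemeasurable_id, ?_⟩
  have := hsq.tendsto
  have hlim : (⟨(stdGaussian (sumZero p)).map ((fun v => ‖v‖ ^ 2) ∘ id),
      Measure.isProbabilityMeasure_map hsq.aemeasurable_limit⟩ : ProbabilityMeasure ℝ) =
      ⟨(chiSquared (p - 1)).map id, Measure.isProbabilityMeasure_map aemeasurable_id⟩ := by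
    apply Subtype.ext
    simp only [Function.comp_id, Measure.map_id]
    exact stdGaussian_map_norm_sq (finrank_sumZero hp)
  rwa [hlim] at this

/-- The relative frequencies converge almost surely to the uniform weights. -/
theorem ae_tendsto_pointCount_div {p : ℕ} {Ω : Type*} [MeasurableSpace Ω]
    {μ : Measure Ω} {X : ℕ → Ω → Points p} (hindep : iIndepFun X μ)
    (hlaw : ∀ k, HasLaw (X k) (discreteDist (fun _ : Points p => 1 / (p : ℝ))) μ) :
    ∀ᵐ ω ∂μ, ∀ i, Tendsto (fun n : ℕ => (pointCount (fun k => X k ω) n i : ℝ) / n) atTop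
      (nhds (1 / (p : ℝ))) := by
  have := hindep.isProbabilityMeasure
  refine ae_all_iff.2 fun i => ?_
  let f : Points p → ℝ := fun j => if j = i then 1 else 0
  have hf : Measurable f := .of_discrete
  have hident (k : ℕ) : IdentDistrib (X k) (X 0) μ μ :=
    ⟨(hlaw k).aemeasurable, (hlaw 0).aemeasurable, by rw [(hlaw k).map_eq, (hlaw 0).map_eq]⟩
  have hmean : ∫ ω, (f ∘ X 0) ω ∂μ = 1 / p := by
    rw [(hlaw 0).integral_comp hf.aestronglyMeasurable, integral_discreteDist_uniform]
    simp [f]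
  have hint : Integrable (f ∘ X 0) μ := by
    refine .of_bound (hf.comp_aemeasurable (hlaw 0).aemeasurable).aestronglyMeasurable 1
      (ae_of_all _ fun ω => ?_)
    simp only [f, Function.comp_apply]
    split_ifs <;> simp
  have h := strong_law_ae_real (fun k => f ∘ X k) hint
    (fun j k hjk => (hindep.indepFun hjk).comp hf hf) fun k => (hident k).comp hf
  filter_upwards [h] with ω hω
  rw [hmean] at hω
  simpa only [pointCount_eq_sum, f, Function.comp_apply] using hω

/-! ### Comparison of the two statistics -/

theorem pearsonStat_eq_mul_sum_sq {p : ℕ} (x : ℕ → Points p) (n : ℕ) :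
    pearsonStat x n = n * (p * ∑ i : Points p, ((pointCount x n i : ℝ) / n - 1 / p) ^ 2) := by
  simp only [pearsonStat, Finset.mul_sum, mul_assoc]

theorem shapeStat_eq_weightShape {p : ℕ} (K : ℝ) (x : ℕ → Points p) (n : ℕ) :
    K * n * (1 - 1 / (p : ℝ) - objectShape (empiricalDist x n)) =
      n * (K * (1 - 1 / (p : ℝ) - weightShape fun i => (pointCount x n i : ℝ) / n)) := by
  -- For `n = 0` the empirical measure is not a probability, but the factor `n` kills both sides.
  rcases eq_or_ne n 0 with rfl | hn
  · simp
  rw [objectShape_empiricalDist x hn]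
  ring

theorem aemeasurable_pointCount {p : ℕ} {Ω : Type*} [MeasurableSpace Ω] {μ : Measure Ω}
    {X : ℕ → Ω → Points p} (hX : ∀ k, AEMeasurable (X k) μ) (n : ℕ) (i : Points p) :
    AEMeasurable (fun ω => (pointCount (fun k => X k ω) n i : ℝ)) μ := by
  simp only [pointCount_eq_sum]
  exact Finset.aemeasurable_fun_sum _ fun k _ =>
    (Measurable.of_discrete (f := fun j : Points p => if j = i then (1 : ℝ) else 0)).comp_aemeasurable
      (hX k)

theorem measurable_weightShape {ι : Type*} [Fintype ι] :
    Measurable (weightShape : (ι → ℝ) → ℝ) := by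
  unfold weightShape
  fun_prop

/-- The ratio of the shape statistic to Pearson's statistic tends to one as the relative
frequencies become uniform. -/
theorem tendsto_shapeStat_sub_pearsonStat_div {p : ℕ} (hp : 3 ≤ p) (x : ℕ → Points p)
    (hx : ∀ i, Tendsto (fun n : ℕ => (pointCount x n i : ℝ) / n) atTop (nhds (1 / (p : ℝ)))) :
    Tendsto (fun n : ℕ => ((p : ℝ) * (p - 1) / (p - 2) * n *
      (1 - 1 / (p : ℝ) - objectShape (empiricalDist x n)) - pearsonStat x n) / pearsonStat x n)
      atTop (nhds 0) := by
  have hp3 : (3 : ℝ) ≤ p := by exact_mod_cast hp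
  have ha : 0 < 1 - 1 / (p : ℝ) := by
    rw [sub_pos, div_lt_one (by positivity)]
    linarith
  have he (i : Points p) :
      Tendsto (fun n : ℕ => (pointCount x n i : ℝ) / n - 1 / p) atTop (nhds 0) := by
    simpa using (hx i).sub_const (1 / (p : ℝ))
  have hq : Tendsto (fun n : ℕ => ∑ i, ((pointCount x n i : ℝ) / n - 1 / p) ^ 2) atTop
      (nhds 0) := by
    simpa using tendsto_finsetSum Finset.univ fun i _ => (he i).pow 2
  have hm : Tendsto (fun n : ℕ => ∑ i, |(pointCount x n i : ℝ) / n - 1 / p|) atTop (nhds 0) := by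
    simpa using tendsto_finsetSum Finset.univ fun i _ => (he i).abs
  have hR := (hq.add (hm.const_mul (((p : ℝ) - 1) / (p - 2)))).div
    (hq.const_sub (1 - 1 / (p : ℝ))) (by simpa using ha.ne')
  simp only [mul_zero, add_zero, zero_div] at hR
  refine squeeze_zero_norm' ?_ hR
  -- The strict bound rules out the 0/0 case: if all observations agree, the sum of squares equals
  -- `1 - 1 / p`.
  filter_upwards [eventually_ne_atTop 0, hq.eventually_lt_const ha] with n hn hlt
  have hn0 : (n : ℝ) ≠ 0 := by exact_mod_cast hn
  have hsum : ∑ i, (pointCount x n i : ℝ) / n = 1 := by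
    rw [← Finset.sum_div, sum_pointCount, div_self hn0]
  have hbound := abs_weightShape_expansion_le hp _ hsum hlt
  have hT : 0 ≤ pearsonStat x n := Finset.sum_nonneg fun i _ => by positivity
  have hnonneg : 0 ≤ (∑ i, ((pointCount x n i : ℝ) / n - 1 / p) ^ 2 +
      ((p : ℝ) - 1) / (p - 2) * ∑ i, |(pointCount x n i : ℝ) / n - 1 / p|) /
        (1 - 1 / (p : ℝ) - ∑ i, ((pointCount x n i : ℝ) / n - 1 / p) ^ 2) := by
    have h1 : 0 ≤ (p : ℝ) - 1 := by linarith
    have h2 : 0 ≤ (p : ℝ) - 2 := by linarith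
    have h3 := sub_nonneg.2 hlt.le
    positivity
  rw [norm_div, Real.norm_eq_abs, Real.norm_of_nonneg hT]
  refine div_le_of_le_mul₀ hT hnonneg ?_
  rw [shapeStat_eq_weightShape, pearsonStat_eq_mul_sum_sq, ← mul_sub, abs_mul, Nat.abs_cast]
  rw [mul_comm _ ((n : ℝ) * _), mul_assoc]
  exact mul_le_mul_of_nonneg_left hbound (Nat.cast_nonneg n)

/-- The shape statistic vanishes together with Pearson's statistic. -/
theorem shapeStat_eq_zero_of_pearsonStat_eq_zero {p : ℕ} (hp : 3 ≤ p) (x : ℕ → Points p) (n : ℕ)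
    (hT : pearsonStat x n = 0) :
    (p : ℝ) * (p - 1) / (p - 2) * n * (1 - 1 / (p : ℝ) - objectShape (empiricalDist x n)) = 0 := by
  have hp3 : (3 : ℝ) ≤ p := by exact_mod_cast hp
  have ha : 0 < 1 - 1 / (p : ℝ) := by
    rw [sub_pos, div_lt_one (by positivity)]
    linarith
  rw [shapeStat_eq_weightShape]
  rcases eq_or_ne n 0 with rfl | hn
  · simp
  have hn0 : (n : ℝ) ≠ 0 := by exact_mod_cast hn
  have hp0 : (p : ℝ) ≠ 0 := by positivity
  have hq : ∑ i, ((pointCount x n i : ℝ) / n - 1 / p) ^ 2 = 0 := by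
    simpa [pearsonStat_eq_mul_sum_sq, hn, show p ≠ 0 by omega] using hT
  have hsum : ∑ i, (pointCount x n i : ℝ) / n = 1 := by
    rw [← Finset.sum_div, sum_pointCount, div_self hn0]
  have hbound := abs_weightShape_expansion_le hp _ hsum (hq ▸ ha)
  rw [hq, mul_zero, zero_mul, sub_zero] at hbound
  rw [abs_nonpos_iff.1 hbound, mul_zero]

theorem theorem9 (p : ℕ) (hp : 3 ≤ p) {Ω : Type*} [MeasurableSpace Ω] (μ : Measure Ω)
    [IsProbabilityMeasure μ] (X : ℕ → Ω → Points p) (hindep : iIndepFun X μ)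
    (hlaw : ∀ k, HasLaw (X k) (discreteDist (fun _ : Points p => 1 / (p : ℝ))) μ) :
    TendstoInMeasure μ
      (fun (n : ℕ) (ω : Ω) =>
        (p : ℝ) * (p - 1) / (p - 2) * n *
            (1 - 1 / (p : ℝ) - objectShape (empiricalDist (fun k => X k ω) n)) -
          pearsonStat (fun k => X k ω) n)
      atTop (fun _ => 0) ∧
    TendstoInDistribution
      (fun (n : ℕ) (ω : Ω) =>
        (p : ℝ) * (p - 1) / (p - 2) * n *
          (1 - 1 / (p : ℝ) - objectShape (empiricalDist (fun k => X k ω) n)))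
      atTop (id : ℝ → ℝ) (fun _ => μ) (chiSquared (p - 1)) := by
  have hT := tendstoInDistribution_pearsonStat (by omega) hindep hlaw
  have hTmeas := hT.forall_aemeasurable
  have hSmeas (n : ℕ) : AEMeasurable (fun ω => (p : ℝ) * (p - 1) / (p - 2) * n *
      (1 - 1 / (p : ℝ) - objectShape (empiricalDist (fun k => X k ω) n))) μ := by
    simp only [shapeStat_eq_weightShape]
    exact ((((measurable_weightShape.comp_aemeasurable (aemeasurable_pi_lambda _ fun i =>
      (aemeasurable_pointCount (fun k => (hlaw k).aemeasurable) n i).div_const _)).const_sub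
      _).const_mul _).const_mul _)
  have hratio_meas (n : ℕ) := ((hSmeas n).sub (hTmeas n)).div (hTmeas n)
  have hratio := tendstoInMeasure_of_tendsto_ae
    (fun n => (hratio_meas n).aestronglyMeasurable) (g := fun _ => (0 : ℝ)) (by
      filter_upwards [ae_tendsto_pointCount_div hindep hlaw] with ω hω
      exact tendsto_shapeStat_sub_pearsonStat_div hp _ hω)
  -- Slutsky: a convergent law times a factor tending to 0 in probability.
  have hprod := hT.continuous_comp_prodMk_of_tendstoInMeasure_const
    (g := fun z : ℝ × ℝ => z.1 * z.2) (by fun_prop) hratio hratio_meas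
  simp only [mul_zero] at hprod
  have hdiff := tendstoInMeasure_of_tendstoInDistribution_const hprod
  have hsub : TendstoInMeasure μ
      (fun (n : ℕ) (ω : Ω) =>
        (p : ℝ) * (p - 1) / (p - 2) * n *
            (1 - 1 / (p : ℝ) - objectShape (empiricalDist (fun k => X k ω) n)) -
          pearsonStat (fun k => X k ω) n)
      atTop (fun _ => 0) := by
    refine hdiff.congr_left fun n => ae_of_all _ fun ω => ?_
    -- Multiplying back recovers the difference even where Pearson's statistic is 0, since the shape
    -- statistic vanishes there too.
    rcases eq_or_ne (pearsonStat (fun k => X k ω) n) 0 with h0 | h0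
    · simp only [Pi.div_apply, Pi.sub_apply]
      rw [shapeStat_eq_zero_of_pearsonStat_eq_zero hp _ n h0, h0]
      simp
    · exact mul_div_cancel₀ _ h0
  exact ⟨hsub, tendstoInDistribution_of_tendstoInMeasure_sub _ _ hT hsub hSmeas⟩
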